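/- Let $\{a_k\}_{k=1}^\infty$ be a nondecreasing sequence of positive integers which is pointwise good: for every probability space $(Y,\mathcal{C},\nu)$, every invertible measure-preserving transformation $S\colon Y\to Y$ and every $g\in L^2(\nu)$, the averages $\frac1N\sum_{k=1}^N g(S^{a_k}y)$ converge, as $N\to\infty$, for $\nu$-a.e. $y\in Y$. Suppose that $\{a_k\}$ satisfies Condition $(*)$: for every $L>0$, \[\lim_{N\to\infty}\frac{1}{N^2}\#\{(i,j)\in[1,N]^2\colon |a_i-a_j|\le L\}=0.\] Let $(X,\mathcal{B},\mu)$ be a probability space and $T\colon X\to X$ an invertible measure-preserving transformation such that $(X,\mathcal{B},\mu,T)$ is a Kolmogorov system: there is a sub-$\sigma$-algebra $\mathcal{P}\subset\mathcal{B}$ with $T^{-1}\mathcal{P}\subset\mathcal{P}$, $\bigvee_{n\ge0}T^{n}\mathcal{P}=\mathcal{B}$ modulo $\mu$-null sets, and $\bigcap_{n\ge0}T^{-n}\mathcal{P}$ trivial modulo $\mu$-null sets (all its members have measure $0$ or $1$). Then for every (real- or complex-valued) $f\in L^2(\mu)$, \[\lim_{N\to\infty}\frac1N\sum_{k=1}^N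 f(T^{a_k}x)=\int f\,d\mu\qquad\text{for $\mu$-a.e. }x\in X.\] -/

import Mathlib

open MeasureTheory Filter Topology

universe u

/-- The average `(1/N) ∑_{k=1}^N f (T^{a_k} x)`. Sequences `a_1, a_2, …` are indexed from zero here:
`a k` stands for `a_{k+1}`, so the sum over `k < N` has the terms `a_1, …, a_N`. -/
noncomputable def seqAverage {𝕜 : Type*} [RCLike 𝕜] {X : Type u}
    (a : ℕ → ℕ) (T : X → X) (f : X → 𝕜) (N : ℕ) (x : X) : 𝕜 :=
  (1 / (N : 𝕜)) * ∑ k ∈ Finset.range N, f (T^[a k] x)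

/-- An increasing (that is, nondecreasing) sequence of positive integers is pointwise good if for
every probability space, every invertible measure preserving transformation `T` of it and every
(real-valued) `f ∈ L²`, the averages of `f` along the sequence converge almost everywhere. -/
structure IsPointwiseGood (a : ℕ → ℕ) : Prop where
  pos : ∀ k, 0 < a k
  mono : Monotone a
  ae_converges : ∀ (X : Type u) [MeasurableSpace X] (μ : Measure X) [IsProbabilityMeasure μ]
    (T : X ≃ᵐ X), MeasurePreserving T μ μ → ∀ f : X → ℝ, MemLp f 2 μ →
      ∀ᵐ x ∂μ, ∃ l : ℝ, Tendsto (fun N : ℕ => seqAverage a T f N x) atTop (𝓝 l)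

/-- Condition (*): for every `L > 0`, `#{(i,j) ∈ [1,N]² : |a_i - a_j| ≤ L} / N² → 0`. -/
def ConditionStar (a : ℕ → ℕ) : Prop :=
  ∀ L : ℝ, 0 < L →
    Tendsto (fun N : ℕ =>
      (Nat.card {p : Fin N × Fin N // |(a p.1 : ℝ) - (a p.2 : ℝ)| ≤ L} : ℝ) / (N : ℝ) ^ 2)
      atTop (𝓝 0)

/-- The invertible measure preserving system `(X, mX, μ, T)` is a Kolmogorov system: there is a
sub-σ-algebra `P` of `mX` with `T⁻¹ P ⊆ P`, such that `⋁_{n ≥ 0} Tⁿ P` is the whole σ-algebra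
modulo `μ`-null sets and `⋂_{n ≥ 0} T⁻ⁿ P` is trivial modulo `μ`-null sets.
Here `P.comap T^[n]` is `{T⁻ⁿ A : A ∈ P}`, and, `T` being a bijection, `P.map T^[n]`, whose members
are the sets `B` with `T⁻ⁿ B ∈ P`, is `{Tⁿ A : A ∈ P}`. -/
structure IsKolmogorovSystem {X : Type u} [mX : MeasurableSpace X] (μ : Measure X)
    (T : X ≃ᵐ X) : Prop where
  measurePreserving : MeasurePreserving T μ μ
  exists_subalgebra : ∃ P : MeasurableSpace X, P ≤ mX ∧
    P.comap T ≤ P ∧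
    (∀ s : Set X, MeasurableSet[mX] s →
      ∃ t : Set X, MeasurableSet[⨆ n : ℕ, P.map (T^[n])] t ∧ s =ᵐ[μ] t) ∧
    (∀ s : Set X, MeasurableSet[⨅ n : ℕ, P.comap (T^[n])] s → μ s = 0 ∨ μ s = 1)

/-!
Since the sequence is pointwise good, the averages of a function in `L²(μ)` converge almost
everywhere, and only the limit has to be identified. It suffices that the averages of a real
function `f` of mean zero tend to zero in `L²(μ)`, for then a subsequence tends to zero almost
everywhere (`ae_tendsto_seqAverage_real`); real and imaginary parts give the general case.

Let `U` be composition with `T`, an isometry of `L²(μ)`. The squared norm of the average is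
`N⁻² ∑ᵢ ∑ⱼ ⟪U ^ aᵢ f, U ^ aⱼ f⟫`, and the term of index `(i, j)` is the autocorrelation
`⟪U ^ n f, f⟫` at `n = |aᵢ - aⱼ|`. If autocorrelations decay, all terms are small except those with
`|aᵢ - aⱼ| ≤ L`, and by Condition (*) these are negligible (`tendsto_average_iterate_zero`).

Autocorrelations decay because Kolmogorov systems are mixing (`tendsto_inner_koopman_iterate`):
functions measurable for some `T ^ m P` are dense in `L²(μ)` by Lévy's upward theorem
(`iSup_lpMeas_topologicalClosure_eq_top`), and for such `h` the function `U ^ (m + n) h` lies in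
`L²(T ^ (-n) P)`, so that only the projection of `f` to that subspace contributes to
`⟪U ^ (m + n) h, f⟫`. These subspaces decrease, and triviality of the tail says that their
intersection consists of the constants (`ae_eq_const_of_forall_aestronglyMeasurable`), to which `f`
is orthogonal; so the projections of `f` tend to zero (`tendsto_starProjection_zero_of_antitone`).
-/

open scoped InnerProductSpace

/-! ### Projections onto a decreasing sequence of subspaces -/

/-- The projections onto a decreasing sequence of subspaces tend to zero on vectors orthogonal to
the intersection: the orthogonal complements increase to a dense subspace of the complement of the
intersection. -/
theorem tendsto_starProjection_zero_of_antitone {E : Type*} [NormedAddCommGroup E]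
    [InnerProductSpace ℝ E] [CompleteSpace E] (K : ℕ → Submodule ℝ E)
    [∀ n, (K n).HasOrthogonalProjection] (hK : Antitone K) {v : E} (hv : v ∈ (⨅ n, K n)ᗮ) :
    Tendsto (fun n => (K n).starProjection v) atTop (𝓝 0) := by
  have hmono : Monotone fun n => (K n)ᗮ := fun i j hij => Submodule.orthogonal_le (hK hij)
  have hclosure : v ∈ (⨆ n, (K n)ᗮ).topologicalClosure := by
    rw [← Submodule.orthogonal_orthogonal_eq_closure, ← Submodule.iInf_orthogonal]
    simpa only [Submodule.orthogonal_orthogonal] using hv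
  have h := Submodule.starProjection_tendsto_closure_iSup (fun n => (K n)ᗮ) hmono v
  rw [Submodule.starProjection_eq_self_iff.2 hclosure] at h
  have h' := (tendsto_const_nhds (x := v)).sub h
  rw [sub_self] at h'
  refine h'.congr fun n => ?_
  rw [Submodule.starProjection_orthogonal_val, sub_sub_cancel]

/-! ### Averages of an isometry along a sequence -/

theorem inner_iterate_iterate {E : Type*} [NormedAddCommGroup E] [InnerProductSpace ℝ E]
    (U : E →ₗᵢ[ℝ] E) (v w : E) (n : ℕ) : ⟪U^[n] v, U^[n] w⟫_ℝ = ⟪v, w⟫_ℝ := by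
  induction n with
  | zero => rfl
  | succ n ih => rw [Function.iterate_succ_apply', Function.iterate_succ_apply',
      U.inner_map_map, ih]

theorem norm_iterate_apply {E : Type*} [NormedAddCommGroup E] [InnerProductSpace ℝ E]
    (U : E →ₗᵢ[ℝ] E) (v : E) (n : ℕ) : ‖U^[n] v‖ = ‖v‖ := by
  rw [norm_eq_sqrt_real_inner, inner_iterate_iterate, ← norm_eq_sqrt_real_inner]

/-- The number of pairs in Condition (*) as a double sum of indicators. -/
theorem card_pairs_eq_sum (a : ℕ → ℕ) (L : ℝ) (N : ℕ) :
    (Nat.card {p : Fin N × Fin N // |(a p.1 : ℝ) - (a p.2 : ℝ)| ≤ L} : ℝ) =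
      ∑ i ∈ Finset.range N, ∑ j ∈ Finset.range N,
        if |(a i : ℝ) - (a j : ℝ)| ≤ L then (1 : ℝ) else 0 := by
  classical
  simp only [Finset.sum_range]
  rw [← Fintype.sum_prod_type' (fun i j : Fin N =>
    if |(a i : ℝ) - (a j : ℝ)| ≤ L then (1 : ℝ) else 0), Finset.sum_boole,
    Nat.card_eq_fintype_card, Fintype.card_subtype]

/-- If the autocorrelations of `v` decay, then two iterates of `v` are nearly orthogonal unless
their times lie within a bounded distance of each other. -/
theorem exists_abs_inner_iterate_le {E : Type*} [NormedAddCommGroup E] [InnerProductSpace ℝ E]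
    (U : E →ₗᵢ[ℝ] E) {v : E} (h : Tendsto (fun n => ⟪U^[n] v, v⟫_ℝ) atTop (𝓝 0))
    {ε : ℝ} (hε : 0 < ε) :
    ∃ L : ℝ, 0 < L ∧ ∀ m n : ℕ, |⟪U^[m] v, U^[n] v⟫_ℝ| ≤
      ε + ‖v‖ ^ 2 * if |(m : ℝ) - (n : ℝ)| ≤ L then 1 else 0 := by
  obtain ⟨M, hM⟩ := Metric.tendsto_atTop.1 h ε hε
  -- `M` itself may be zero, while Condition (*) speaks of positive distances.
  refine ⟨M + 1, by positivity, ?_⟩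
  have key : ∀ m n : ℕ, n ≤ m → |⟪U^[m] v, U^[n] v⟫_ℝ| ≤
      ε + ‖v‖ ^ 2 * if |(m : ℝ) - (n : ℝ)| ≤ (M : ℝ) + 1 then 1 else 0 := by
    intro m n hnm
    split_ifs with hL
    · have := abs_real_inner_le_norm (U^[m] v) (U^[n] v)
      rw [norm_iterate_apply, norm_iterate_apply] at this
      nlinarith
    · obtain ⟨d, rfl⟩ := Nat.exists_eq_add_of_le hnm
      rw [Function.iterate_add_apply, inner_iterate_iterate]
      have hd : M ≤ d := by
        by_contra hlt
        apply hL
        push_cast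
        rw [add_sub_cancel_left, abs_of_nonneg (by positivity)]
        have : (d : ℝ) ≤ M := by exact_mod_cast (not_le.1 hlt).le
        linarith
      have := hM d hd
      rw [Real.dist_eq, sub_zero] at this
      linarith
  intro m n
  rcases le_total n m with hnm | hmn
  · exact key m n hnm
  · rw [real_inner_comm, abs_sub_comm]
    exact key n m hmn

/-- The square of the norm of the average is the mean of the correlations of its terms, and
Condition (*) makes the pairs of terms with a large correlation negligible. -/
theorem tendsto_average_iterate_zero {E : Type*} [NormedAddCommGroup E] [InnerProductSpace ℝ E]
    (U : E →ₗᵢ[ℝ] E) {a : ℕ → ℕ} (ha : ConditionStar a) {v : E}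
    (h : Tendsto (fun n => ⟪U^[n] v, v⟫_ℝ) atTop (𝓝 0)) :
    Tendsto (fun N : ℕ => (1 / (N : ℝ)) • ∑ k ∈ Finset.range N, U^[a k] v) atTop (𝓝 0) := by
  suffices hsq : Tendsto (fun N : ℕ => ‖(1 / (N : ℝ)) • ∑ k ∈ Finset.range N, U^[a k] v‖ ^ 2)
      atTop (𝓝 0) by
    rw [tendsto_zero_iff_norm_tendsto_zero]
    have hsqrt := (Real.continuous_sqrt.tendsto 0).comp hsq
    rw [Real.sqrt_zero] at hsqrt
    exact hsqrt.congr fun N => Real.sqrt_sq (norm_nonneg _)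
  rw [Metric.tendsto_atTop]
  intro ε hε
  obtain ⟨L, hL, hbound⟩ := exists_abs_inner_iterate_le U h (half_pos hε)
  have hlim := ((ha L hL).const_mul (‖v‖ ^ 2)).const_add (ε / 2)
  rw [mul_zero, add_zero] at hlim
  obtain ⟨N₀, hN₀⟩ := eventually_atTop.1 (hlim.eventually_lt_const (half_lt_self hε))
  -- At `N = 0` the factor `1 / N` is zero and cannot be cancelled.
  refine ⟨max N₀ 1, fun N hN => ?_⟩
  have hN1 : 0 < (N : ℝ) := by exact_mod_cast (le_max_right N₀ 1).trans hN
  rw [Real.dist_eq, sub_zero, abs_of_nonneg (by positivity)]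
  refine lt_of_le_of_lt ?_ (hN₀ N ((le_max_left _ _).trans hN))
  have hsum : ‖∑ k ∈ Finset.range N, U^[a k] v‖ ^ 2 ≤ (N : ℝ) ^ 2 * (ε / 2) + ‖v‖ ^ 2 *
      (Nat.card {p : Fin N × Fin N // |(a p.1 : ℝ) - (a p.2 : ℝ)| ≤ L} : ℝ) := by
    rw [card_pairs_eq_sum, ← real_inner_self_eq_norm_sq, sum_inner]
    simp_rw [inner_sum]
    calc ∑ i ∈ Finset.range N, ∑ j ∈ Finset.range N, ⟪U^[a i] v, U^[a j] v⟫_ℝ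
        ≤ ∑ i ∈ Finset.range N, ∑ j ∈ Finset.range N, (ε / 2 + ‖v‖ ^ 2 *
            if |(a i : ℝ) - (a j : ℝ)| ≤ L then 1 else 0) :=
          Finset.sum_le_sum fun i _ => Finset.sum_le_sum fun j _ =>
            (le_abs_self _).trans (hbound _ _)
      _ = _ := by
          simp only [Finset.sum_add_distrib, ← Finset.mul_sum, Finset.sum_const,
            Finset.card_range, nsmul_eq_mul]
          ring
  rw [norm_smul, mul_pow, Real.norm_eq_abs, sq_abs]
  calc (1 / (N : ℝ)) ^ 2 * ‖∑ k ∈ Finset.range N, U^[a k] v‖ ^ 2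
      ≤ (1 / (N : ℝ)) ^ 2 * _ := mul_le_mul_of_nonneg_left hsum (by positivity)
    _ = _ := by field_simp

/-! ### Trivial tails and generating filtrations in `L²` -/

/-- A function that is measurable, up to null sets, for every σ-algebra of a decreasing sequence
with trivial intersection is constant: it agrees with the upper limit of its versions, which is
measurable for the intersection. -/
theorem ae_eq_const_of_forall_aestronglyMeasurable {X : Type*} [MeasurableSpace X]
    {μ : Measure X} [IsProbabilityMeasure μ] {Q : ℕ → MeasurableSpace X} (hQ : Antitone Q)
    (hle : ∀ n, Q n ≤ ‹MeasurableSpace X›)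
    (htriv : ∀ s, MeasurableSet[⨅ n, Q n] s → μ s = 0 ∨ μ s = 1) {g : X → ℝ}
    (hg : ∀ n, AEStronglyMeasurable[Q n] g μ) : ∃ c : ℝ, g =ᵐ[μ] Function.const X c := by
  choose g' hg'meas hg' using hg
  let G : X → ℝ := fun x => limsup (fun n => g' n x) atTop
  have hGg : g =ᵐ[μ] G := by
    filter_upwards [ae_all_iff.2 hg'] with x hx
    simp only [G, ← hx, limsup_const]
  have hGmeas : ∀ N, Measurable[Q N] G := by
    intro N
    have hshift : G = fun x => limsup (fun n => g' (n + N) x) atTop :=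
      funext fun x => (limsup_nat_add (fun n => g' n x) N).symm
    rw [hshift]
    have hmeas : ∀ n, Measurable[Q N] (g' (n + N)) := fun n =>
      ((hg'meas (n + N)).measurable).mono (hQ (Nat.le_add_left N n)) le_rfl
    exact Measurable.limsup (mδ := Q N) hmeas
  obtain ⟨c, hc⟩ := exists_eventuallyEq_const_of_forall_separating (l := ae μ) (f := G)
    MeasurableSet fun s hs => by
      have htail : MeasurableSet[⨅ n, Q n] (G ⁻¹' s) :=
        MeasurableSpace.measurableSet_iInf.2 fun n => hGmeas n hs
      rcases htriv _ htail with h0 | h1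
      · exact Or.inr (measure_eq_zero_iff_ae_notMem.1 h0)
      · exact Or.inl ((prob_compl_eq_zero_iff (hle 0 _ (hGmeas 0 hs))).2 h1)
  exact ⟨c, hGg.trans hc⟩

theorem setIntegral_eq_zero_of_mem_lpMeas_orthogonal {X : Type*} {m mX : MeasurableSpace X}
    {μ : Measure X} [IsFiniteMeasure μ] (hm : m ≤ mX) {v : Lp ℝ 2 μ}
    (hv : v ∈ (lpMeas ℝ ℝ m 2 μ)ᗮ) {s : Set X} (hs : MeasurableSet[m] s) :
    ∫ x in s, v x ∂μ = 0 := by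
  rw [← L2.inner_indicatorConstLp_one (𝕜 := ℝ) (hm s hs) (measure_ne_top μ s)]
  exact hv _ (mem_lpMeas_indicatorConstLp hm hs (measure_ne_top μ s))

/-- An `L²` function orthogonal to all functions measurable for some term of a filtration that
generates the σ-algebra modulo null sets vanishes, by Lévy's upward theorem. -/
theorem iSup_lpMeas_topologicalClosure_eq_top {X : Type*} [mX : MeasurableSpace X]
    {μ : Measure X} [IsProbabilityMeasure μ] (F : Filtration ℕ mX)
    (hgen : ∀ s, MeasurableSet s → ∃ t, MeasurableSet[⨆ n, F n] t ∧ s =ᵐ[μ] t) :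
    (⨆ n, lpMeas ℝ ℝ (F n) 2 μ).topologicalClosure = ⊤ := by
  rw [Submodule.topologicalClosure_eq_top_iff, Submodule.eq_bot_iff]
  intro v hv
  rw [← Submodule.iInf_orthogonal, Submodule.mem_iInf] at hv
  have hint : Integrable v μ := (Lp.memLp v).integrable (by norm_num)
  have hcond : ∀ n, (0 : X → ℝ) =ᵐ[μ] μ[v | F n] := fun n =>
    ae_eq_condExp_of_forall_setIntegral_eq (F.le n) hint
      (fun s _ _ => integrableOn_zero)
      (fun s hs _ => by
        rw [setIntegral_eq_zero_of_mem_lpMeas_orthogonal (F.le n) (hv n) hs]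
        simp)
      aestronglyMeasurable_zero
  have hsup : μ[v | ⨆ n, F n] =ᵐ[μ] 0 := by
    filter_upwards [tendsto_ae_condExp (ℱ := F) (μ := μ) v, ae_all_iff.2 hcond] with x hx h0
    refine tendsto_nhds_unique hx ?_
    simp only [← h0]
    exact tendsto_const_nhds
  refine (Lp.eq_zero_iff_ae_eq_zero).2 (hint.ae_eq_zero_of_forall_setIntegral_eq_zero ?_)
  intro s hs _
  obtain ⟨t, ht, hst⟩ := hgen s hs
  rw [setIntegral_congr_set hst, ← setIntegral_condExp (iSup_le F.le) hint ht,
    integral_congr_ae (ae_restrict_of_ae hsup)]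
  simp

/-! ### Mixing of Kolmogorov systems -/

theorem antitone_comap_iterate {X : Type*} {P : MeasurableSpace X} {T : X → X}
    (hP : P.comap T ≤ P) : Antitone fun n : ℕ => P.comap T^[n] := by
  refine antitone_nat_of_succ_le fun n => ?_
  rw [Function.iterate_succ', ← MeasurableSpace.comap_comp]
  exact MeasurableSpace.comap_mono hP

theorem monotone_map_iterate {X : Type*} {P : MeasurableSpace X} {T : X → X}
    (hP : P.comap T ≤ P) : Monotone fun n : ℕ => P.map T^[n] :=
  monotone_nat_of_le_succ fun n s hs => hP _ ⟨T^[n] ⁻¹' s, hs, rfl⟩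

/-- Composition with `T` as an isometry of `L²(μ)`. -/
noncomputable abbrev koopman {X : Type*} [MeasurableSpace X] {μ : Measure X} {T : X → X}
    (hT : MeasurePreserving T μ μ) : Lp ℝ 2 μ →ₗᵢ[ℝ] Lp ℝ 2 μ :=
  Lp.compMeasurePreservingₗᵢ ℝ T hT

theorem coeFn_koopman_iterate {X : Type*} [MeasurableSpace X] {μ : Measure X} {T : X → X}
    (hT : MeasurePreserving T μ μ) (v : Lp ℝ 2 μ) (n : ℕ) :
    (koopman hT)^[n] v =ᵐ[μ] v ∘ T^[n] := by
  have h : (koopman hT)^[n] v = Lp.compMeasurePreserving T^[n] (hT.iterate n) v :=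
    congrFun (Lp.compMeasurePreserving_iterate hT n) v
  rw [h]
  exact Lp.coeFn_compMeasurePreserving v (hT.iterate n)

/-- The Koopman isometry moves the functions of the past `T ^ m P` into the remote past. -/
theorem koopman_iterate_mem_lpMeas {X : Type*} {P : MeasurableSpace X} [mX : MeasurableSpace X]
    {μ : Measure X} {T : X → X} (hT : MeasurePreserving T μ μ) {m : ℕ} {h : Lp ℝ 2 μ}
    (hh : h ∈ lpMeas ℝ ℝ (P.map T^[m]) 2 μ) (n : ℕ) :
    (koopman hT)^[m + n] h ∈ lpMeas ℝ ℝ (P.comap T^[n]) 2 μ := by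
  rw [mem_lpMeas_iff_aestronglyMeasurable] at hh ⊢
  obtain ⟨h', hmeas, hae⟩ := hh
  refine ⟨h' ∘ T^[m + n], ?_, (coeFn_koopman_iterate hT h (m + n)).trans
    ((hT.iterate (m + n)).quasiMeasurePreserving.ae_eq_comp hae)⟩
  rw [Function.iterate_add, ← Function.comp_assoc]
  have hTm : Measurable[P, P.map T^[m]] T^[m] := fun _ hs => hs
  have hTn : Measurable[P.comap T^[n], P] T^[n] := measurable_iff_comap_le.2 le_rfl
  exact (hmeas.comp_measurable hTm).comp_measurable hTn

/-- Kolmogorov systems are mixing. A function of `T ^ m P` is moved by the isometry into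
`L²(T ^ (-n) P)`, where the projections of a function of mean zero tend to zero because the tail is
trivial; such functions are dense. -/
theorem tendsto_inner_koopman_iterate {X : Type*} {P : MeasurableSpace X}
    [mX : MeasurableSpace X] {μ : Measure X} [IsProbabilityMeasure μ] {T : X ≃ᵐ X}
    (hT : MeasurePreserving T μ μ) (hPle : P ≤ mX) (hP : P.comap T ≤ P)
    (hgen : ∀ s, MeasurableSet s → ∃ t, MeasurableSet[⨆ n : ℕ, P.map T^[n]] t ∧ s =ᵐ[μ] t)
    (htriv : ∀ s, MeasurableSet[⨅ n : ℕ, P.comap T^[n]] s → μ s = 0 ∨ μ s = 1)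
    (f : Lp ℝ 2 μ) {g : Lp ℝ 2 μ} (hg : ∫ x, g x ∂μ = 0) :
    Tendsto (fun n => ⟪(koopman hT)^[n] f, g⟫_ℝ) atTop (𝓝 0) := by
  set U := koopman hT
  have hcomap : ∀ n : ℕ, P.comap T^[n] ≤ mX := fun n =>
    (antitone_comap_iterate hP (Nat.zero_le n)).trans (by simpa using hPle)
  let F : Filtration ℕ mX :=
    { seq := fun n => P.map T^[n]
      mono' := monotone_map_iterate hP
      le' := fun n s hs => by
        have hpre : MeasurableSet (T^[n] ⁻¹' s) := hPle _ hs
        have hinv : Function.RightInverse T.symm^[n] T^[n] :=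
          Function.RightInverse.iterate T.apply_symm_apply n
        have := (T.symm.measurable.iterate n) hpre
        rwa [← Set.preimage_comp, hinv.comp_eq_id, Set.preimage_id] at this }
  let K : ℕ → Submodule ℝ (Lp ℝ 2 μ) := fun n => lpMeas ℝ ℝ (P.comap T^[n]) 2 μ
  have hK : Antitone K := fun i j hij v hv => by
    simp only [K, mem_lpMeas_iff_aestronglyMeasurable] at hv ⊢
    exact hv.mono (antitone_comap_iterate hP hij)
  have : ∀ n, (K n).HasOrthogonalProjection := fun n => by
    have : Fact (P.comap T^[n] ≤ mX) := ⟨hcomap n⟩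
    have : CompleteSpace (K n) := inferInstanceAs (CompleteSpace (lpMeas ℝ ℝ _ 2 μ))
    infer_instance
  have hgK : g ∈ (⨅ n, K n)ᗮ := by
    intro w hw
    rw [Submodule.mem_iInf] at hw
    obtain ⟨c, hc⟩ := ae_eq_const_of_forall_aestronglyMeasurable (antitone_comap_iterate hP)
      hcomap htriv fun n => mem_lpMeas_iff_aestronglyMeasurable.1 (hw n)
    rw [L2.inner_def]
    have : ∫ x, ⟪w x, g x⟫_ℝ ∂μ = ∫ x, g x * c ∂μ :=
      integral_congr_ae (hc.mono fun x hx => by simp [hx])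
    rw [this, integral_mul_const, hg, zero_mul]
  have hproj := tendsto_starProjection_zero_of_antitone K hK hgK
  have hpast : ∀ m, ∀ h ∈ lpMeas ℝ ℝ (F m) 2 μ,
      Tendsto (fun n => ⟪U^[n] h, g⟫_ℝ) atTop (𝓝 0) := by
    intro m h hh
    rw [← tendsto_add_atTop_iff_nat m]
    refine squeeze_zero_norm (fun n => ?_) (by simpa using hproj.norm.const_mul ‖h‖)
    have hmem : U^[n + m] h ∈ K n := by
      rw [add_comm]
      exact koopman_iterate_mem_lpMeas hT hh n
    -- As `U ^ (n + m) h` lies in `K n`, its inner product sees only the projection of `g`.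
    rw [← Submodule.starProjection_eq_self_iff.2 hmem,
      Submodule.inner_starProjection_left_eq_right]
    exact (norm_inner_le_norm _ _).trans_eq (by rw [norm_iterate_apply])
  have hdense : f ∈ (⨆ n, lpMeas ℝ ℝ (F n) 2 μ).topologicalClosure := by
    rw [iSup_lpMeas_topologicalClosure_eq_top F hgen]
    trivial
  have hdir : Monotone fun n => lpMeas ℝ ℝ (F n) 2 μ := fun i j hij v hv => by
    simp only [mem_lpMeas_iff_aestronglyMeasurable] at hv ⊢
    exact hv.mono (F.mono hij)
  rw [Metric.tendsto_atTop]
  intro ε hε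
  have hδ : 0 < ε / 2 / (‖g‖ + 1) := by positivity
  obtain ⟨h, hh, hfh⟩ := Metric.mem_closure_iff.1 hdense _ hδ
  obtain ⟨m, hm⟩ := (Submodule.mem_iSup_of_directed _ hdir.directed_le).1 hh
  obtain ⟨N, hN⟩ := Metric.tendsto_atTop.1 (hpast m h hm) (ε / 2) (half_pos hε)
  refine ⟨N, fun n hn => ?_⟩
  have hsplit : ⟪U^[n] f, g⟫_ℝ = ⟪U^[n] (f - h), g⟫_ℝ + ⟪U^[n] h, g⟫_ℝ := by
    rw [← inner_add_left, ← iterate_map_add, sub_add_cancel]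
  have h1 : |⟪U^[n] (f - h), g⟫_ℝ| ≤ ε / 2 := by
    refine (abs_real_inner_le_norm _ _).trans ?_
    rw [norm_iterate_apply, ← dist_eq_norm]
    calc dist f h * ‖g‖ ≤ ε / 2 / (‖g‖ + 1) * (‖g‖ + 1) :=
          mul_le_mul hfh.le (by linarith) (norm_nonneg _) hδ.le
      _ = ε / 2 := by field_simp
  have h2 := hN n hn
  rw [Real.dist_eq, sub_zero] at h2 ⊢
  rw [hsplit]
  exact (abs_add_le _ _).trans_lt (by linarith)

theorem IsKolmogorovSystem.tendsto_inner_koopman_iterate {X : Type u} [mX : MeasurableSpace X]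
    {μ : Measure X} [IsProbabilityMeasure μ] {T : X ≃ᵐ X} (hT : IsKolmogorovSystem μ T)
    (f : Lp ℝ 2 μ) {g : Lp ℝ 2 μ} (hg : ∫ x, g x ∂μ = 0) :
    Tendsto (fun n => ⟪(koopman hT.measurePreserving)^[n] f, g⟫_ℝ) atTop (𝓝 0) := by
  have hmp := hT.measurePreserving
  obtain ⟨P, hPle, hP, hgen, htriv⟩ := hT.exists_subalgebra
  exact _root_.tendsto_inner_koopman_iterate (mX := mX) hmp hPle hP hgen htriv f hg

/-! ### Identification of the pointwise limit -/

theorem seqAverage_sub_const {X : Type u} (a : ℕ → ℕ) (T : X → X) (f : X → ℝ) (c : ℝ) {N : ℕ}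
    (hN : N ≠ 0) (x : X) :
    seqAverage a T (fun y => f y - c) N x = seqAverage a T f N x - c := by
  have : (N : ℝ) ≠ 0 := Nat.cast_ne_zero.2 hN
  simp only [seqAverage, Finset.sum_sub_distrib, Finset.sum_const, Finset.card_range, nsmul_eq_mul]
  field_simp

theorem coeFn_average_koopman {X : Type u} [MeasurableSpace X] {μ : Measure X} {T : X → X}
    (hT : MeasurePreserving T μ μ) (a : ℕ → ℕ) {f : X → ℝ} (hf : MemLp f 2 μ) (N : ℕ) :
    ((1 / (N : ℝ)) • ∑ k ∈ Finset.range N, (koopman hT)^[a k] (hf.toLp f) : Lp ℝ 2 μ)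
      =ᵐ[μ] seqAverage a T f N := by
  have hk : ∀ k, (koopman hT)^[a k] (hf.toLp f) =ᵐ[μ] f ∘ T^[a k] := fun k =>
    (coeFn_koopman_iterate hT _ _).trans
      ((hT.iterate (a k)).quasiMeasurePreserving.ae_eq_comp hf.coeFn_toLp)
  filter_upwards [Lp.coeFn_smul (1 / (N : ℝ))
      (∑ k ∈ Finset.range N, (koopman hT)^[a k] (hf.toLp f)),
    Lp.coeFn_finsetSum (Finset.range N) fun k => (koopman hT)^[a k] (hf.toLp f),
    ae_all_iff.2 hk] with x h1 h2 h3
  rw [h1, Pi.smul_apply, h2]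
  simp [seqAverage, h3]

/-- The averages of a real function converge to its mean: their limit exists almost everywhere, and
a subsequence converges to the mean almost everywhere because the averages converge in `L²`. -/
theorem ae_tendsto_seqAverage_real {a : ℕ → ℕ} (ha : IsPointwiseGood.{u} a)
    (hstar : ConditionStar a) {X : Type u} [MeasurableSpace X] {μ : Measure X}
    [IsProbabilityMeasure μ] {T : X ≃ᵐ X} (hT : IsKolmogorovSystem μ T) {f : X → ℝ}
    (hf : MemLp f 2 μ) :
    ∀ᵐ x ∂μ, Tendsto (fun N : ℕ => seqAverage a T f N x) atTop (𝓝 (∫ y, f y ∂μ)) := by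
  set c := ∫ y, f y ∂μ with hc
  have hg : MemLp (fun y => f y - c) 2 μ := hf.sub (memLp_const c)
  have hmean : ∫ x, hg.toLp _ x ∂μ = 0 := by
    rw [integral_congr_ae hg.coeFn_toLp,
      integral_sub (hf.integrable (by norm_num)) (integrable_const c)]
    simp [hc]
  have hL2 := tendsto_average_iterate_zero (koopman hT.measurePreserving) hstar
    (hT.tendsto_inner_koopman_iterate _ hmean)
  obtain ⟨ns, hns, hsub⟩ := (tendstoInMeasure_of_tendsto_Lp hL2).exists_seq_tendsto_ae
  filter_upwards [ha.ae_converges X μ T hT.measurePreserving f hf, hsub,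
    ae_all_iff.2 (coeFn_average_koopman hT.measurePreserving a hg),
    Lp.coeFn_zero ℝ 2 μ] with x hconv hx havg h0
  obtain ⟨l, hl⟩ := hconv
  -- Along the subsequence the averages of `f - c` are those of `f` minus `c`, except at `N = 0`.
  have hlim : Tendsto (fun i => seqAverage a T f (ns i) x - c) atTop (𝓝 0) := by
    rw [h0] at hx
    refine hx.congr' ?_
    filter_upwards [hns.tendsto_atTop.eventually_ne_atTop 0] with i hi
    rw [havg, seqAverage_sub_const a T f c hi]
  have := tendsto_nhds_unique ((hl.comp hns.tendsto_atTop).sub_const c) hlim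
  rwa [sub_eq_zero.1 this] at hl

theorem re_seqAverage {𝕜 : Type*} [RCLike 𝕜] {X : Type u} (a : ℕ → ℕ) (T : X → X) (f : X → 𝕜)
    (N : ℕ) (x : X) :
    RCLike.re (seqAverage a T f N x) = seqAverage a T (fun y => RCLike.re (f y)) N x := by
  have : (1 / (N : 𝕜)) = ((1 / (N : ℝ) : ℝ) : 𝕜) := by simp
  rw [seqAverage, this, RCLike.re_ofReal_mul, map_sum]
  rfl

theorem im_seqAverage {𝕜 : Type*} [RCLike 𝕜] {X : Type u} (a : ℕ → ℕ) (T : X → X) (f : X → 𝕜)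
    (N : ℕ) (x : X) :
    RCLike.im (seqAverage a T f N x) = seqAverage a T (fun y => RCLike.im (f y)) N x := by
  have : (1 / (N : 𝕜)) = ((1 / (N : ℝ) : ℝ) : 𝕜) := by simp
  rw [seqAverage, this, RCLike.im_ofReal_mul, map_sum]
  rfl

theorem mainTheorem10 {𝕜 : Type*} [RCLike 𝕜] (a : ℕ → ℕ)
    (ha : IsPointwiseGood.{u} a) (hstar : ConditionStar a)
    {X : Type u} [MeasurableSpace X] (μ : Measure X) [IsProbabilityMeasure μ]
    (T : X ≃ᵐ X) (hT : IsKolmogorovSystem μ T)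
    (f : X → 𝕜) (hf : MemLp f 2 μ) :
    ∀ᵐ x ∂μ, Tendsto (fun N : ℕ => seqAverage a T f N x) atTop (𝓝 (∫ y, f y ∂μ)) := by
  have hint : Integrable f μ := hf.integrable (by norm_num)
  filter_upwards [ae_tendsto_seqAverage_real ha hstar hT hf.re,
    ae_tendsto_seqAverage_real ha hstar hT hf.im] with x hre him
  have h := ((RCLike.continuous_ofReal (K := 𝕜)).tendsto _ |>.comp hre).add
    (((RCLike.continuous_ofReal (K := 𝕜)).tendsto _ |>.comp him).mul_const RCLike.I)
  rw [integral_re_add_im hint] at h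
  refine h.congr fun N => ?_
  simp only [Function.comp_apply, ← re_seqAverage, ← im_seqAverage]
  exact RCLike.re_add_im _
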